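/- Let $L$ be a Dedekind complete unital $f$-algebra, i.e. a Dedekind complete vector lattice that is also an associative real algebra with unit $1$, such that products of nonnegative elements are nonnegative and $a\wedge b=0$, $c\ge 0$ imply $(ca)\wedge b=(ac)\wedge b=0$ (such an algebra is automatically commutative, and every $a\ge 0$ in $L$ has a unique square root $\sqrt a\ge 0$). Let $\mathbb{L}$ be either $L$ itself (real scalars) or its complexification $L+iL$ (complex scalars), with $\overline{\lambda}$ denoting complex conjugation (the identity in the real case). An $\mathbb{L}$-inner product on an $\mathbb{L}$-module $H$ is a map $\langle\cdot,\cdot\rangle\colon H\times H\to\mathbb{L}$ that is $\mathbb{L}$-linear in the first variable and satisfies $\langle x,y\rangle=\overline{\langle y,x\rangle}$, $\langle x,x\rangle\in L$, $\langle x,x\rangle\ge 0$, and $\langle x,x\rangle=0\Rightarrow x=0$. Put $\|x\|=\sqrt{\langle x,x\rangle}\in L$. A net $(x_\alpha)$ in $H$ converges to $x$ if there is a set $\mathcal{E}$ of nonnegative elements of $L$ with $\inf\mathcal{E}=0$ such that for every $\varepsilon\in\mathcal{E}$ there is $\alpha_0$ with $\|x_\alpha-x\|\le\varepsilon$ for all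 $\alpha\ge\alpha_0$; it is Cauchy if there is such an $\mathcal{E}$ such that for every $\varepsilon\in\mathcal{E}$ there is $\alpha_0$ with $\|x_\alpha-x_\beta\|\le\varepsilon$ for all $\alpha,\beta\ge\alpha_0$. $H$ is an $\mathbb{L}$-Hilbert space if every Cauchy net in $H$ converges, and a subset of $H$ is closed if it contains the limit of every convergent net of its elements. Theorem. Let $H$ be an $\mathbb{L}$-Hilbert space, let $M\subseteq H$ be a closed $\mathbb{L}$-submodule, and let $M^\perp=\{x\in H:\langle x,y\rangle=0\text{ for all }y\in M\}$. (1) For every $x\in H$ there is a unique $y\in M$ with $\|x-y\|=\inf_{z\in M}\|x-z\|$. (2) For $x\in H$ and $y\in M$, one has $\|x-y\|=\inf_{z\in M}\|x-z\|$ if and only if $\langle x-y,z\rangle=0$ for all $z\in M$. (3) $H=M\oplus M^\perp$. (4) For every $x\in H$ there is a unique $y\in M$ with $x-y\in M^\perp$; write $P_Mx=y$. The map $P_M\colon H\to H$ is $\mathbb{L}$-linear and contractive (that is, bounded with $\|P_M\|:=\inf\{c\in L: c\ge 0,\ \|P_Mx\|\le c\|x\|\text{ for all }x\in H\}\le 1$),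 $P_M^2=P_M$, $\ker P_M=M^\perp$, and $\operatorname{ran}P_M=M$. -/

import Mathlib

universe u v w

namespace LHilbert

/-- A unital `f`-algebra: a real associative unital algebra `L` which is a vector lattice (the order
is compatible with addition and with multiplication by nonnegative reals), in which products of
nonnegative elements are nonnegative and in which multiplication by nonnegative elements, on either
side, preserves disjointness. Dedekind completeness is expressed by the separate instance
`ConditionallyCompleteLattice L`. -/
class UnitalFAlgebra (L : Type u) [Ring L] [Algebra ℝ L] [Lattice L] : Prop
    extends IsOrderedAddMonoid L where
  smul_nonneg : ∀ (r : ℝ) (a : L), 0 ≤ r → 0 ≤ a → 0 ≤ r • a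
  mul_nonneg : ∀ a b : L, 0 ≤ a → 0 ≤ b → 0 ≤ a * b
  mul_inf_eq_zero : ∀ a b c : L, a ⊓ b = 0 → 0 ≤ c → (c * a) ⊓ b = 0
  inf_mul_eq_zero : ∀ a b c : L, a ⊓ b = 0 → 0 ≤ c → (a * c) ⊓ b = 0

/-- The complexification `L + iL`. -/
@[ext] structure Complexification (L : Type u) where
  re : L
  im : L

namespace Complexification

variable {L : Type u} [Ring L]

instance : Zero (Complexification L) := ⟨⟨0, 0⟩⟩
instance : One (Complexification L) := ⟨⟨1, 0⟩⟩
instance : Add (Complexification L) := ⟨fun z w => ⟨z.re + w.re, z.im + w.im⟩⟩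
instance : Neg (Complexification L) := ⟨fun z => ⟨-z.re, -z.im⟩⟩
instance : Mul (Complexification L) :=
  ⟨fun z w => ⟨z.re * w.re - z.im * w.im, z.re * w.im + z.im * w.re⟩⟩

@[simp] theorem zero_re : (0 : Complexification L).re = 0 := rfl
@[simp] theorem zero_im : (0 : Complexification L).im = 0 := rfl
@[simp] theorem one_re : (1 : Complexification L).re = 1 := rfl
@[simp] theorem one_im : (1 : Complexification L).im = 0 := rfl
@[simp] theorem add_re (z w : Complexification L) : (z + w).re = z.re + w.re := rfl
@[simp] theorem add_im (z w : Complexification L) : (z + w).im = z.im + w.im := rfl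
@[simp] theorem neg_re (z : Complexification L) : (-z).re = -z.re := rfl
@[simp] theorem neg_im (z : Complexification L) : (-z).im = -z.im := rfl
@[simp] theorem mul_re (z w : Complexification L) :
    (z * w).re = z.re * w.re - z.im * w.im := rfl
@[simp] theorem mul_im (z w : Complexification L) :
    (z * w).im = z.re * w.im + z.im * w.re := rfl

instance : Ring (Complexification L) where
  add_assoc a b c := by ext <;> simp [add_assoc]
  zero_add a := by ext <;> simp
  add_zero a := by ext <;> simp
  add_comm a b := by ext <;> simp [add_comm]
  neg_add_cancel a := by ext <;> simp
  mul_assoc a b c := by ext <;> simp <;> noncomm_ring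
  one_mul a := by ext <;> simp
  mul_one a := by ext <;> simp
  zero_mul a := by ext <;> simp
  mul_zero a := by ext <;> simp
  left_distrib a b c := by ext <;> simp <;> noncomm_ring
  right_distrib a b c := by ext <;> simp <;> noncomm_ring
  nsmul := nsmulRec
  zsmul := zsmulRec

end Complexification

/-- Whether the scalars are `L` itself or its complexification. -/
inductive ScalarKind
  | real
  | complex

/-- The scalar ring `𝕃`: the real algebra `L` or its complexification `L + iL`. -/
def Scalar (k : ScalarKind) (L : Type u) : Type u :=
  match k with
  | .real => L
  | .complex => Complexification L

namespace Scalar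

variable {k : ScalarKind} {L : Type u} [Ring L]

instance : Ring (Scalar k L) :=
  match k with
  | .real => inferInstanceAs (Ring L)
  | .complex => inferInstanceAs (Ring (Complexification L))

/-- Real part of a scalar. -/
def re : {k : ScalarKind} → Scalar k L → L
  | .real, a => a
  | .complex, z => Complexification.re z

/-- Imaginary part of a scalar (zero for real scalars). -/
def im : {k : ScalarKind} → Scalar k L → L
  | .real, _ => 0
  | .complex, z => Complexification.im z

/-- Complex conjugation of scalars (the identity for real scalars). -/
def conj : {k : ScalarKind} → Scalar k L → Scalar k L
  | .real, a => a
  | .complex, z => (⟨Complexification.re z, -Complexification.im z⟩ : Complexification L)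

end Scalar

/-- The square root of `a ≥ 0` in `L`: the largest `b ≥ 0` with `b * b ≤ a`. -/
noncomputable def sqrt {L : Type u} [Ring L] [ConditionallyCompleteLattice L] (a : L) : L :=
  sSup {b : L | 0 ≤ b ∧ b * b ≤ a}

/-- An `𝕃`-valued inner product on the `𝕃`-module `H`, where `𝕃 = Scalar k L`. The scalar `⟨x, x⟩`
is nonnegative, that is, it is real and its real part is nonnegative in `L`. -/
structure InnerProduct (k : ScalarKind) (L : Type u) [Ring L] [Lattice L]
    (H : Type v) [AddCommGroup H] [Module (Scalar k L) H] where
  inner : H → H → Scalar k L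
  inner_self_nonneg : ∀ x, 0 ≤ (inner x x).re ∧ (inner x x).im = 0
  conj_symm : ∀ x y, inner x y = (inner y x).conj
  add_left : ∀ x y z, inner (x + y) z = inner x z + inner y z
  smul_left : ∀ (a : Scalar k L) (x y : H), inner (a • x) y = a * inner x y
  definite : ∀ x, inner x x = 0 → x = 0

section Norm

variable {L : Type u} [Ring L] [ConditionallyCompleteLattice L]

/-- `E ↘ 0`: a set of nonnegative elements with infimum `0` (not necessarily directed). -/
def DecreasesToZero (E : Set L) : Prop :=
  (∀ e ∈ E, 0 ≤ e) ∧ IsGLB E 0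

variable {H : Type v} [AddCommGroup H]

/-- Convergence of a net `s` to `x` with respect to an `L`-valued norm `N`. -/
def NetTendsto (N : H → L) {I : Type w} [Preorder I] (s : I → H) (x : H) : Prop :=
  ∃ E : Set L, DecreasesToZero E ∧ ∀ e ∈ E, ∃ i₀ : I, ∀ i, i₀ ≤ i → N (s i - x) ≤ e

/-- Cauchy nets with respect to an `L`-valued norm `N`. -/
def NetCauchy (N : H → L) {I : Type w} [Preorder I] (s : I → H) : Prop :=
  ∃ E : Set L, DecreasesToZero E ∧
    ∀ e ∈ E, ∃ i₀ : I, ∀ i j, i₀ ≤ i → i₀ ≤ j → N (s i - s j) ≤ e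

/-- Every Cauchy net converges. Index sets of nets range over a universe that contains (lifts of)
all subsets of `L` and of `H`; since the convergence of a net is controlled by a subset of `L`,
larger index sets give nothing new. -/
def NetComplete (N : H → L) : Prop :=
  ∀ (I : Type (max u v)) [Preorder I] [IsDirected I (· ≤ ·)] [Nonempty I] (s : I → H),
    NetCauchy N s → ∃ x, NetTendsto N s x

/-- A set is closed if it contains the limits of all convergent nets of its elements. -/
def NetClosed (N : H → L) (A : Set H) : Prop :=
  ∀ (I : Type (max u v)) [Preorder I] [IsDirected I (· ≤ ·)] [Nonempty I] (s : I → H) (x : H),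
    (∀ i, s i ∈ A) → NetTendsto N s x → x ∈ A

/-- A map is bounded if `N (T x) ≤ c * N x` for all `x`, for some `c ≥ 0` in `L`. -/
def IsBoundedMap (N : H → L) (T : H → H) : Prop :=
  ∃ c : L, 0 ≤ c ∧ ∀ x, N (T x) ≤ c * N x

/-- The `L`-valued operator norm. -/
noncomputable def opNorm (N : H → L) (T : H → H) : L :=
  sInf {c : L | 0 ≤ c ∧ ∀ x, N (T x) ≤ c * N x}

/-- A contractive map: bounded, with operator norm at most `1`. -/
def IsContractive (N : H → L) (T : H → H) : Prop :=
  IsBoundedMap N T ∧ opNorm N T ≤ 1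

end Norm

namespace InnerProduct

variable {k : ScalarKind} {L : Type u} [Ring L] [ConditionallyCompleteLattice L]
  {H : Type v} [AddCommGroup H] [Module (Scalar k L) H]

/-- The `L`-valued norm `‖x‖ = √⟨x, x⟩`. -/
noncomputable def norm (ip : InnerProduct k L H) (x : H) : L :=
  sqrt (ip.inner x x).re

/-- `H` is an `𝕃`-Hilbert space: it is complete for the norm of its inner product. -/
def IsHilbert (ip : InnerProduct k L H) : Prop :=
  NetComplete ip.norm

/-- The orthogonal complement `{x | ⟨x, y⟩ = 0 for all y ∈ M}`. -/
def orthogonal (ip : InnerProduct k L H) (M : Submodule (Scalar k L) H) :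
    Submodule (Scalar k L) H where
  carrier := {x | ∀ y ∈ M, ip.inner x y = 0}
  add_mem' {a b} ha hb y hy := by rw [ip.add_left, ha y hy, hb y hy, add_zero]
  zero_mem' y _ := by
    have h := ip.smul_left 0 0 y
    rwa [zero_smul, zero_mul] at h
  smul_mem' c x hx y hy := by rw [ip.smul_left, hx y hy, mul_zero]

/-- `y` is a point of `M` nearest to `x`: `y ∈ M` and `‖x - y‖ = inf_{z ∈ M} ‖x - z‖`. -/
def IsNearestPoint (ip : InnerProduct k L H) (M : Submodule (Scalar k L) H) (x y : H) : Prop :=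
  y ∈ M ∧ IsGLB {d : L | ∃ z ∈ M, d = ip.norm (x - z)} (ip.norm (x - y))

end InnerProduct

end LHilbert

/-!
The proof follows the classical one over `ℝ` or `ℂ`, once four facts about a Dedekind complete
unital `f`-algebra `L` are available.

* `L` is commutative (`UnitalFAlgebra.mul_comm`). The commutator with `c ≥ 0` preserves disjointness
  and kills `1`, so a bound for it on `[0, 1]` can be halved indefinitely
  (`abs_commutator_le_pow_smul`); the unbounded part `(x - 1)⁺` of `x ≥ 0` is controlled by `x²`.
* The square root of `a ≥ 0`, defined as a supremum, does satisfy `√a * √a = a`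
  (`sqrt_mul_self`): otherwise the supremum could be moved by a small nonzero element, which
  `eq_zero_of_forall_mul_le` supplies in place of division.
* Squaring reflects the order of nonnegative elements (`le_of_mul_self_le_mul_self`), so that
  inequalities between norms are inequalities between the elements `⟨x, x⟩` of `L`.
* For each `f` in `L` there is an idempotent `p` with `p f = f⁺`
  (`exists_idempotent_mul_eq_posPart`).

Since `L` is not totally ordered, minimizing sequences are not available. Instead, two points `z` and
`w` of `M` are glued to `p z + (1 - p) w`, whose distance to `x` is the infimum of their distances,
for a suitable idempotent `p` (`exists_mem_reInner_le`). So `M` itself, ordered by decreasing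
distance to `x`, is a directed index set, and the inclusion of `M` in `H` is a net. By the
parallelogram law it is Cauchy, and its limit is nearest to `x` (`exists_isNearestPoint`). Nearest
points are then characterized by orthogonality (`isNearestPoint_iff_inner_eq_zero`) through a
variational argument in which division by `⟨z, z⟩` is replaced by the Archimedean property. The rest
follows from `H = M ⊕ M^⊥` and Pythagoras.
-/

namespace LHilbert

/-! ### Elementary properties of unital `f`-algebras -/

namespace UnitalFAlgebra

section Ring

variable {L : Type u} [Ring L] [Algebra ℝ L] [ConditionallyCompleteLattice L] [UnitalFAlgebra L]

theorem mul_eq_zero_of_inf_eq_zero {a b : L} (h : a ⊓ b = 0) : a * b = 0 := by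
  have ha : 0 ≤ a := h ▸ inf_le_left
  have hb : 0 ≤ b := h ▸ inf_le_right
  have h1 : b ⊓ (a * b) = 0 := by rw [inf_comm]; exact inf_mul_eq_zero a b b h hb
  simpa using mul_inf_eq_zero b (a * b) a h1 ha

theorem posPart_mul_negPart (a : L) : a⁺ * a⁻ = 0 :=
  mul_eq_zero_of_inf_eq_zero (posPart_inf_negPart_eq_zero a)

theorem negPart_mul_posPart (a : L) : a⁻ * a⁺ = 0 :=
  mul_eq_zero_of_inf_eq_zero (by rw [inf_comm]; exact posPart_inf_negPart_eq_zero a)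

theorem mul_self_nonneg (a : L) : 0 ≤ a * a := by
  have h : a * a = a⁺ * a⁺ + a⁻ * a⁻ := by
    conv_lhs => rw [← posPart_sub_negPart a]
    rw [sub_mul, mul_sub, mul_sub, posPart_mul_negPart, negPart_mul_posPart]
    abel
  rw [h]
  exact add_nonneg (mul_nonneg _ _ (posPart_nonneg a) (posPart_nonneg a))
    (mul_nonneg _ _ (negPart_nonneg a) (negPart_nonneg a))

instance : IsOrderedRing L :=
  haveI : ZeroLEOneClass L := ⟨by simpa using mul_self_nonneg (1 : L)⟩
  IsOrderedRing.of_mul_nonneg mul_nonneg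

instance : IsOrderedModule ℝ L :=
  IsOrderedModule.of_smul_nonneg fun r hr a ha => smul_nonneg r a hr ha

/-- A Dedekind complete vector lattice is Archimedean. -/
theorem nonpos_of_forall_nsmul_le {x y : L} (h : ∀ n : ℕ, n • x ≤ y) : x ≤ 0 := by
  have hbdd : BddAbove (Set.range fun n : ℕ => n • x) := ⟨y, by rintro _ ⟨n, rfl⟩; exact h n⟩
  have h1 : (⨆ n : ℕ, n • x) ≤ (⨆ n : ℕ, n • x) - x := by
    refine ciSup_le fun n => le_sub_iff_add_le.2 ?_
    rw [← succ_nsmul]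
    exact le_ciSup hbdd (n + 1)
  simpa using h1

theorem eq_zero_of_forall_nsmul_abs_le {x y : L} (h : ∀ n : ℕ, n • |x| ≤ y) : x = 0 := by
  have h1 := nonpos_of_forall_nsmul_le h
  exact le_antisymm ((le_abs_self x).trans h1) (neg_nonpos.1 ((neg_le_abs x).trans h1))

theorem add_inf_eq_zero {a b c : L} (ha : a ⊓ c = 0) (hb : b ⊓ c = 0) : (a + b) ⊓ c = 0 := by
  have ha0 : 0 ≤ a := ha ▸ inf_le_left
  have hb0 : 0 ≤ b := hb ▸ inf_le_left
  have hc0 : 0 ≤ c := hb ▸ inf_le_right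
  refine le_antisymm ?_ (le_inf (add_nonneg ha0 hb0) hc0)
  refine (le_inf ?_ inf_le_right).trans hb.le
  refine sub_nonpos.1 ((le_inf ?_ ?_).trans ha.le)
  · exact sub_le_iff_le_add.2 inf_le_left
  · exact (sub_le_self _ hb0).trans inf_le_right

theorem inf_eq_zero_of_le {α : Type*} [Lattice α] [Zero α] {a b c : α} (h : b ⊓ c = 0)
    (ha : 0 ≤ a) (hab : a ≤ b) : a ⊓ c = 0 :=
  le_antisymm ((inf_le_inf_right c hab).trans h.le) (le_inf ha (h ▸ inf_le_right))

/-! ### Commutativity -/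

theorem abs_commutator_le {a c d : L} (hc : 0 ≤ c) (ha : 0 ≤ a) (had : a ≤ d) :
    |c * a - a * c| ≤ c * d + d * c := by
  have h1 := mul_nonneg c a hc ha
  have h2 := mul_nonneg a c ha hc
  have h3 : c * a ≤ c * d := mul_le_mul_of_nonneg_left had hc
  have h4 : a * c ≤ d * c := mul_le_mul_of_nonneg_right had hc
  refine abs_le'.2 ⟨?_, ?_⟩
  · exact (sub_le_self _ h2).trans (h3.trans (le_add_of_nonneg_right (h2.trans h4)))
  · rw [neg_sub]
    exact (sub_le_self _ h1).trans (h4.trans (le_add_of_nonneg_left (h1.trans h3)))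

/-- A commutator with a nonnegative element preserves disjointness. -/
theorem abs_commutator_inf_eq_zero {a b c : L} (hc : 0 ≤ c) (h : a ⊓ b = 0) :
    |c * a - a * c| ⊓ b = 0 :=
  inf_eq_zero_of_le (add_inf_eq_zero (mul_inf_eq_zero a b c h hc) (inf_mul_eq_zero a b c h hc))
    (abs_nonneg _) (abs_commutator_le hc (h ▸ inf_le_left) le_rfl)

/-- The commutator with `c` vanishes at `1`, so with `f = 2b - 1` its value at `2b` is the
difference of its values at `f⁺` and `f⁻`, which are disjoint. Hence every bound for the commutator
on `[0, 1]` can be halved. -/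
theorem abs_commutator_le_pow_smul {c : L} (hc : 0 ≤ c) (n : ℕ) :
    ∀ b : L, 0 ≤ b → b ≤ 1 → |c * b - b * c| ≤ (1 / 2 : ℝ) ^ n • (c + c) := by
  induction n with
  | zero =>
    intro b hb hb1
    simpa using abs_commutator_le hc hb hb1
  | succ n ih =>
    intro b hb hb1
    set f : L := b + b - 1 with hf
    have hp : f⁺ ≤ 1 := sup_le (sub_le_iff_le_add.2 (add_le_add hb1 hb1)) zero_le_one
    have hn : f⁻ ≤ 1 := sup_le (by rw [hf, neg_sub]; exact sub_le_self _ (add_nonneg hb hb))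
      zero_le_one
    have hd : |c * f⁺ - f⁺ * c| ⊓ |c * f⁻ - f⁻ * c| = 0 := by
      rw [inf_comm]
      refine abs_commutator_inf_eq_zero hc ?_
      rw [inf_comm]
      exact abs_commutator_inf_eq_zero hc (posPart_inf_negPart_eq_zero f)
    have he : (c * b - b * c) + (c * b - b * c) =
        (c * f⁺ - f⁺ * c) - (c * f⁻ - f⁻ * c) := by
      have h1 : (c * f⁺ - f⁺ * c) - (c * f⁻ - f⁻ * c) = c * (f⁺ - f⁻) - (f⁺ - f⁻) * c := by
        noncomm_ring
      rw [h1, posPart_sub_negPart, hf]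
      noncomm_ring
    have h2 : |(c * b - b * c) + (c * b - b * c)| ≤ (1 / 2 : ℝ) ^ n • (c + c) := by
      rw [he]
      have h3 := inf_add_sup |c * f⁺ - f⁺ * c| |c * f⁻ - f⁻ * c|
      rw [hd, zero_add] at h3
      rw [sub_eq_add_neg]
      refine (abs_add_le _ _).trans ?_
      rw [abs_neg, ← h3]
      exact sup_le (ih _ (posPart_nonneg f) hp) (ih _ (negPart_nonneg f) hn)
    have h4 : ∀ x y : L, x + x ≤ (1 / 2 : ℝ) ^ n • y → x ≤ (1 / 2 : ℝ) ^ (n + 1) • y := by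
      intro x y hxy
      have h5 := smul_le_smul_of_nonneg_left hxy (show (0 : ℝ) ≤ 1 / 2 by norm_num)
      rwa [smul_smul, ← pow_succ', ← two_smul ℝ x, smul_smul, one_div,
        inv_mul_cancel₀ two_ne_zero, one_smul, ← one_div] at h5
    obtain ⟨h6, h7⟩ := abs_le'.1 h2
    exact abs_le'.2 ⟨h4 _ _ h6, h4 _ _ (by rwa [neg_add] at h7)⟩

theorem commutator_eq_zero_of_le_one {b c : L} (hc : 0 ≤ c) (hb : 0 ≤ b) (hb1 : b ≤ 1) :
    c * b - b * c = 0 := by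
  refine eq_zero_of_forall_nsmul_abs_le (y := c + c) fun n => ?_
  have h1 := abs_commutator_le_pow_smul hc n b hb hb1
  have h2 := smul_le_smul_of_nonneg_left h1 (Nat.cast_nonneg (α := ℝ) n)
  rw [smul_smul, Nat.cast_smul_eq_nsmul] at h2
  refine h2.trans (smul_le_of_le_one_left (add_nonneg hc hc) ?_)
  have h3 : (n : ℝ) ≤ 2 ^ n := by exact_mod_cast Nat.lt_two_pow_self.le
  rw [one_div, inv_pow]
  exact mul_inv_le_one_of_le₀ h3 (by positivity)

theorem posPart_sub_one_le_mul_self (a : L) (ha : 0 ≤ a) : (a - 1)⁺ ≤ a * a := by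
  refine sup_le ?_ (mul_self_nonneg a)
  have h1 : a * a - (a - 1) = (a - 1) * (a - 1) + a := by noncomm_ring
  rw [← sub_nonneg, h1]
  exact add_nonneg (mul_self_nonneg _) ha

theorem mul_comm_of_nonneg {a c : L} (hc : 0 ≤ c) (ha : 0 ≤ a) : c * a = a * c := by
  rw [← sub_eq_zero]
  refine eq_zero_of_forall_nsmul_abs_le (y := c * (a * a) + (a * a) * c) fun n => ?_
  have hy : 0 ≤ c * (a * a) + (a * a) * c :=
    add_nonneg (mul_nonneg _ _ hc (mul_self_nonneg a)) (mul_nonneg _ _ (mul_self_nonneg a) hc)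
  rcases n.eq_zero_or_pos with rfl | hn
  · simpa using hy
  have hn' : (n : ℝ) ≠ 0 := by positivity
  have hx : 0 ≤ (n : ℝ)⁻¹ • a := smul_nonneg _ _ (by positivity) ha
  set x : L := (n : ℝ)⁻¹ • a with hxa
  have hax : a = (n : ℝ) • x := by rw [hxa, smul_smul, mul_inv_cancel₀ hn', one_smul]
  -- Split `x` into `x ⊓ 1`, which commutes with `c`, and `(x - 1)⁺`, which is at most `x²`.
  have hsplit : x = x ⊓ 1 + (x - 1)⁺ := by
    have : x - 1 ⊓ x = (x - 1)⁺ := by rw [posPart_def, sub_inf, sub_self]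
    rw [← this, inf_comm]; abel
  have h1 := commutator_eq_zero_of_le_one hc (le_inf hx zero_le_one) inf_le_right
  have h2 : c * x - x * c = c * (x - 1)⁺ - (x - 1)⁺ * c := by
    conv_lhs => rw [hsplit]
    rw [mul_add, add_mul, add_sub_add_comm, h1, zero_add]
  have h3 : |c * x - x * c| ≤ c * (x * x) + (x * x) * c := by
    rw [h2]
    exact abs_commutator_le hc (posPart_nonneg _) (posPart_sub_one_le_mul_self x hx)
  have h4 : c * a - a * c = (n : ℝ) • (c * x - x * c) := by
    rw [hax, mul_smul_comm, smul_mul_assoc, smul_sub]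
  have h5 : c * (a * a) + (a * a) * c = ((n : ℝ) * n) • (c * (x * x) + (x * x) * c) := by
    rw [hax]
    simp only [mul_smul_comm, smul_mul_assoc, smul_add, smul_smul]
  have h6 : |(n : ℝ) • (c * x - x * c)| ≤ (n : ℝ) • |c * x - x * c| := by
    refine abs_le'.2 ⟨smul_le_smul_of_nonneg_left (le_abs_self _) n.cast_nonneg, ?_⟩
    rw [← smul_neg]
    exact smul_le_smul_of_nonneg_left (neg_le_abs _) n.cast_nonneg
  rw [h4, h5, ← Nat.cast_smul_eq_nsmul ℝ, ← smul_smul]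
  refine smul_le_smul_of_nonneg_left (h6.trans ?_) n.cast_nonneg
  exact smul_le_smul_of_nonneg_left h3 n.cast_nonneg

protected theorem mul_comm (a b : L) : a * b = b * a := by
  rw [← posPart_sub_negPart a, ← posPart_sub_negPart b]
  simp only [sub_mul, mul_sub]
  rw [mul_comm_of_nonneg (posPart_nonneg a) (posPart_nonneg b),
    mul_comm_of_nonneg (posPart_nonneg a) (negPart_nonneg b),
    mul_comm_of_nonneg (negPart_nonneg a) (posPart_nonneg b),
    mul_comm_of_nonneg (negPart_nonneg a) (negPart_nonneg b)]
  abel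

/-- The commutative ring structure of a Dedekind complete unital `f`-algebra, extending the
given ring structure. -/
abbrev toCommRing : CommRing L := { ‹Ring L› with mul_comm := UnitalFAlgebra.mul_comm }

end Ring

end UnitalFAlgebra

/-! ### Square roots -/

section SquareRoot

variable {L : Type u} [Ring L] [Algebra ℝ L] [ConditionallyCompleteLattice L] [UnitalFAlgebra L]

open UnitalFAlgebra (mul_self_nonneg mul_eq_zero_of_inf_eq_zero inf_eq_zero_of_le
  nonpos_of_forall_nsmul_le)

attribute [local instance] UnitalFAlgebra.toCommRing

theorem eq_zero_of_mul_self_nonpos {a : L} (ha : a * a ≤ 0) : a = 0 := by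
  have ha0 : a * a = 0 := le_antisymm ha (mul_self_nonneg a)
  have key : ∀ b : L, b * b = 0 → b + b ≤ 0 := by
    intro b hb
    refine nonpos_of_forall_nsmul_le (y := 1) fun n => ?_
    have h1 : (1 - n * b) * (1 - n * b) = 1 - n • (b + b) := by
      rw [nsmul_eq_mul]
      linear_combination (n ^ 2 : L) * hb
    rw [← sub_nonneg, ← h1]
    exact mul_self_nonneg _
  have h2 : a + a = 0 := by
    refine le_antisymm (key a ha0) (neg_nonpos.1 ?_)
    rw [neg_add]
    exact key (-a) (by rw [neg_mul_neg, ha0])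
  rw [← two_smul ℝ a] at h2
  simpa [smul_smul] using congrArg ((2⁻¹ : ℝ) • ·) h2

theorem le_of_mul_self_le_mul_self {a b : L} (ha : 0 ≤ a) (hb : 0 ≤ b) (h : a * a ≤ b * b) :
    a ≤ b := by
  set p := (a - b)⁺ with hp
  have hp0 : 0 ≤ p := posPart_nonneg _
  have hpa : p ≤ a := sup_le (sub_le_self _ hb) ha
  have h1 : p * p = p * (a - b) := by
    conv_rhs => rw [← posPart_sub_negPart (a - b)]
    rw [mul_sub, UnitalFAlgebra.posPart_mul_negPart, sub_zero]
  have h2 : p * p * p ≤ 0 := by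
    calc p * p * p ≤ p * p * (a + b) :=
          mul_le_mul_of_nonneg_left (hpa.trans (le_add_of_nonneg_right hb)) (mul_self_nonneg p)
      _ = p * (a * a - b * b) := by rw [h1]; ring
      _ ≤ 0 := mul_nonpos_of_nonneg_of_nonpos hp0 (sub_nonpos.2 h)
  have h3 : p * p = 0 := eq_zero_of_mul_self_nonpos <| by
    rw [← mul_assoc]
    exact mul_nonpos_of_nonpos_of_nonneg h2 hp0
  have h4 : p = 0 := eq_zero_of_mul_self_nonpos h3.le
  exact sub_nonpos.1 (posPart_eq_zero.1 h4)

/-- `1` is a weak order unit. -/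
theorem eq_zero_of_inf_one_eq_zero {a : L} (h : a ⊓ 1 = 0) : a = 0 := by
  simpa using mul_eq_zero_of_inf_eq_zero h

/-- Given `w, g ≥ 0` with `w ≠ 0`, some `t ≠ 0` in `[0, 1]` satisfies `t ≤ w` and `t * g ≤ w`. Up to
scaling, one takes `(n w - g)⁺ ⊓ 1`, which is disjoint from `(n w - g)⁻`, for suitable `n`. -/
theorem eq_zero_of_forall_mul_le {w g : L} (hw : 0 ≤ w) (hg : 0 ≤ g)
    (h : ∀ t : L, 0 ≤ t → t ≤ 1 → t ≤ w → t * g ≤ w → t = 0) : w = 0 := by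
  refine le_antisymm (nonpos_of_forall_nsmul_le (y := g) fun n => ?_) hw
  rcases n.eq_zero_or_pos with rfl | hn
  · simpa using hg
  have hn0 : (0 : ℝ) < n := by positivity
  have hn1 : (1 : ℝ) ≤ n := by exact_mod_cast hn
  rw [← Nat.cast_smul_eq_nsmul ℝ]
  set f : L := (n : ℝ) • w - g with hf
  set t : L := f⁺ ⊓ 1 with ht
  have ht0 : 0 ≤ t := le_inf (posPart_nonneg f) zero_le_one
  have htf : t * f⁻ = 0 := mul_eq_zero_of_inf_eq_zero
    (inf_eq_zero_of_le (posPart_inf_negPart_eq_zero f) ht0 inf_le_left)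
  have h1 : t * g ≤ (n : ℝ) • w := by
    have h2 : 0 ≤ t * f := by
      rw [← posPart_sub_negPart f, mul_sub, htf, sub_zero]
      exact mul_nonneg ht0 (posPart_nonneg f)
    rw [hf, mul_sub, sub_nonneg, mul_smul_comm] at h2
    exact h2.trans (smul_le_smul_of_nonneg_left (mul_le_of_le_one_left hw inf_le_right) hn0.le)
  have h3 : t ≤ (n : ℝ) • w := inf_le_left.trans
    (sup_le (sub_le_self _ hg) (smul_nonneg hn0.le hw))
  have h4 : ∀ x : L, x ≤ (n : ℝ) • w → (n : ℝ)⁻¹ • x ≤ w := fun x hx => by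
    have := smul_le_smul_of_nonneg_left hx (inv_nonneg.2 hn0.le)
    rwa [smul_smul, inv_mul_cancel₀ hn0.ne', one_smul] at this
  have h5 := h ((n : ℝ)⁻¹ • t) (smul_nonneg (inv_nonneg.2 hn0.le) ht0)
    ((smul_le_of_le_one_left ht0 (inv_le_one_of_one_le₀ hn1)).trans inf_le_right) (h4 t h3)
    (by rw [smul_mul_assoc]; exact h4 _ h1)
  have h6 : t = 0 := by
    simpa [smul_smul, hn0.ne'] using congrArg ((n : ℝ) • ·) h5
  exact sub_nonpos.1 (posPart_eq_zero.1 (eq_zero_of_inf_one_eq_zero h6))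

theorem le_sqrt {a b : L} (hb : 0 ≤ b) (h : b * b ≤ a) : b ≤ sqrt a := by
  refine le_csSup ⟨1 + a, ?_⟩ ⟨hb, h⟩
  rintro c ⟨hc, hca⟩
  have h1 : 0 ≤ (c - 1) * (c - 1) := mul_self_nonneg _
  rw [← sub_nonneg] at hca ⊢
  have h2 : 1 + a - c = (c - 1) * (c - 1) + (a - c * c) + c := by ring
  rw [h2]
  exact add_nonneg (add_nonneg h1 hca) hc

theorem sqrt_nonneg {a : L} (ha : 0 ≤ a) : 0 ≤ sqrt a := le_sqrt le_rfl (by simpa using ha)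

theorem sqrt_mul_self_le {a : L} (ha : 0 ≤ a) : sqrt a * sqrt a ≤ a := by
  set s := sqrt a with hs
  have hs0 : 0 ≤ s := sqrt_nonneg ha
  -- If `t ≥ 0` is so small that `t * 2s ≤ (s² - a)⁺`, then `s - t ⊓ s` still bounds the set whose
  -- supremum is `s`.
  have key : (s * s - a)⁺ = 0 := by
    refine eq_zero_of_forall_mul_le (posPart_nonneg _) (add_nonneg hs0 hs0) fun t ht _ htw hts => ?_
    have hr0 : 0 ≤ t ⊓ s := le_inf ht hs0
    have h1 : s ≤ s - t ⊓ s := by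
      refine csSup_le ⟨0, le_rfl, by simpa using ha⟩ ?_
      rintro c ⟨hc, hca⟩
      refine le_of_mul_self_le_mul_self hc (sub_nonneg.2 inf_le_right) ?_
      have hcs : c ≤ s := le_sqrt hc hca
      have h2 : (s * s - a)⁺ ≤ s * s - c * c :=
        sup_le (sub_le_sub_left hca _) (sub_nonneg.2 (mul_self_le_mul_self hc hcs))
      have h3 : (t ⊓ s) * (s + s) ≤ s * s - c * c :=
        ((mul_le_mul_of_nonneg_right inf_le_left (add_nonneg hs0 hs0)).trans hts).trans h2
      rw [← sub_nonneg] at h3 ⊢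
      have h4 : (s - t ⊓ s) * (s - t ⊓ s) - c * c =
          (s * s - c * c - (t ⊓ s) * (s + s)) + (t ⊓ s) * (t ⊓ s) := by ring
      rw [h4]
      exact add_nonneg h3 (mul_self_nonneg _)
    have h5 : t ⊓ s = 0 := le_antisymm (by simpa using h1) hr0
    have h6 : s * s ⊓ t = 0 := by
      rw [inf_comm] at h5
      exact UnitalFAlgebra.mul_inf_eq_zero _ _ _ h5 hs0
    have h7 : t ≤ s * s := htw.trans (sup_le (sub_le_self _ ha) (mul_self_nonneg s))
    rwa [inf_eq_right.2 h7] at h6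
  exact sub_nonpos.1 (posPart_eq_zero.1 key)

theorem sqrt_mul_self {a : L} (ha : 0 ≤ a) : sqrt a * sqrt a = a := by
  have hs := sqrt_mul_self_le ha
  have hs0 : 0 ≤ sqrt a := sqrt_nonneg ha
  refine le_antisymm hs (sub_nonpos.1 (le_of_eq ?_))
  -- If `t ∈ [0, 1]` is so small that `t * (2s + 1) ≤ a - s²`, then `(s + t)² ≤ a`.
  refine eq_zero_of_forall_mul_le (g := sqrt a + sqrt a + 1) (sub_nonneg.2 hs)
    (add_nonneg (add_nonneg hs0 hs0) zero_le_one) fun t ht ht1 _ htg => ?_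
  have h1 : sqrt a + t ≤ sqrt a := by
    refine le_sqrt (add_nonneg hs0 ht) ?_
    have h2 : t * t ≤ t := mul_le_of_le_one_left ht ht1
    rw [← sub_nonneg] at htg h2 ⊢
    have h3 : a - (sqrt a + t) * (sqrt a + t) =
        (a - sqrt a * sqrt a - t * (sqrt a + sqrt a + 1)) + (t - t * t) := by ring
    rw [h3]
    exact add_nonneg htg h2
  exact le_antisymm (by simpa using h1) ht

theorem sqrt_le_sqrt_iff {a b : L} (ha : 0 ≤ a) (hb : 0 ≤ b) : sqrt a ≤ sqrt b ↔ a ≤ b := by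
  refine ⟨fun h => ?_, fun h => le_of_mul_self_le_mul_self (sqrt_nonneg ha) (sqrt_nonneg hb) ?_⟩
  · rw [← sqrt_mul_self ha, ← sqrt_mul_self hb]
    exact mul_self_le_mul_self (sqrt_nonneg ha) h
  · rwa [sqrt_mul_self ha, sqrt_mul_self hb]

end SquareRoot

/-! ### Components of the unit -/

section Component

variable {L : Type u} [Ring L] [Algebra ℝ L] [ConditionallyCompleteLattice L] [UnitalFAlgebra L]

open UnitalFAlgebra

/-- The band projection onto the band generated by `f⁺`, as multiplication by an idempotent `p`:
the largest element of `[0, 1]` disjoint from `f⁻`. -/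
theorem exists_idempotent_mul_eq_posPart (f : L) : ∃ p : L, p * p = p ∧ p * f = f⁺ := by
  set S : Set L := {e | 0 ≤ e ∧ e ≤ 1 ∧ e ⊓ f⁻ = 0} with hS
  have h0 : (0 : L) ∈ S := ⟨le_rfl, zero_le_one, inf_eq_left.2 (negPart_nonneg f)⟩
  have hbdd : BddAbove S := ⟨1, fun e he => he.2.1⟩
  set p := sSup S with hp
  have hp0 : 0 ≤ p := le_csSup hbdd h0
  have hp1 : p ≤ 1 := csSup_le ⟨0, h0⟩ fun e he => he.2.1
  have hpf : p ⊓ f⁻ = 0 := by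
    have hr : 0 ≤ p ⊓ f⁻ := le_inf hp0 (negPart_nonneg f)
    have h1 : p ≤ p - p ⊓ f⁻ := by
      refine csSup_le ⟨0, h0⟩ fun e he => ?_
      have h2 : p ⊓ f⁻ ⊓ e = 0 :=
        inf_eq_zero_of_le (by rw [inf_comm]; exact he.2.2) hr inf_le_right
      have h3 := inf_add_sup (p ⊓ f⁻) e
      rw [h2, zero_add] at h3
      rw [le_sub_iff_add_le, add_comm, ← h3]
      exact sup_le inf_le_left (le_csSup hbdd he)
    exact le_antisymm (by simpa using h1) hr
  -- Nothing positive can be added to `p` inside `S`.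
  have hmax : ∀ r : L, 0 ≤ r → r ≤ 1 - p → r ⊓ f⁻ = 0 → r = 0 := by
    intro r hr hr1 hrf
    have h1 : p + r ∈ S := ⟨add_nonneg hp0 hr, by rwa [add_comm, ← le_sub_iff_add_le],
      add_inf_eq_zero hpf hrf⟩
    exact le_antisymm ((add_le_iff_nonpos_right p).1 (le_csSup hbdd h1)) hr
  have h1p : 0 ≤ 1 - p := sub_nonneg.2 hp1
  have h2 : p ⊓ (1 - p) = 0 :=
    hmax _ (le_inf hp0 h1p) inf_le_right (inf_eq_zero_of_le hpf (le_inf hp0 h1p) inf_le_left)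
  have h3 : (1 - p) ⊓ f⁺ = 0 :=
    hmax _ (le_inf h1p (posPart_nonneg f)) inf_le_left
      (inf_eq_zero_of_le (posPart_inf_negPart_eq_zero f) (le_inf h1p (posPart_nonneg f))
        inf_le_right)
  have h4 := mul_eq_zero_of_inf_eq_zero h2
  have h5 := mul_eq_zero_of_inf_eq_zero h3
  have h6 := mul_eq_zero_of_inf_eq_zero hpf
  rw [mul_sub, mul_one, sub_eq_zero] at h4
  rw [sub_mul, one_mul, sub_eq_zero] at h5
  refine ⟨p, h4.symm, ?_⟩
  conv_lhs => rw [← posPart_sub_negPart f]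
  rw [mul_sub, h6, sub_zero, ← h5]

end Component

/-! ### Scalars -/

namespace Scalar

section Ring

variable {k : ScalarKind} {L : Type u} [Ring L]

/-- An element of `L` as a scalar. -/
def ofReal : {k : ScalarKind} → L → Scalar k L
  | .real, a => a
  | .complex, a => (⟨a, 0⟩ : Complexification L)

@[simp] theorem ofReal_re (a : L) : (ofReal a : Scalar k L).re = a := by cases k <;> rfl

@[simp] theorem ofReal_im (a : L) : (ofReal a : Scalar k L).im = 0 := by cases k <;> rfl

@[simp] theorem zero_re : (0 : Scalar k L).re = 0 := by cases k <;> rfl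

@[simp] theorem zero_im : (0 : Scalar k L).im = 0 := by cases k <;> rfl

@[simp] theorem one_re : (1 : Scalar k L).re = 1 := by cases k <;> rfl

@[simp] theorem one_im : (1 : Scalar k L).im = 0 := by cases k <;> rfl

@[simp] theorem add_re (z w : Scalar k L) : (z + w).re = z.re + w.re := by cases k <;> rfl

@[simp] theorem add_im (z w : Scalar k L) : (z + w).im = z.im + w.im := by
  cases k
  · exact (add_zero 0).symm
  · rfl

@[simp] theorem mul_re (z w : Scalar k L) : (z * w).re = z.re * w.re - z.im * w.im := by
  cases k
  · exact (by rw [mul_zero, sub_zero] : z.re * w.re = z.re * w.re - (0 : L) * 0)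
  · rfl

@[simp] theorem conj_re (z : Scalar k L) : z.conj.re = z.re := by cases k <;> rfl

@[simp] theorem conj_im (z : Scalar k L) : z.conj.im = -z.im := by
  cases k
  · exact neg_zero.symm
  · rfl

theorem ext {z w : Scalar k L} (hre : z.re = w.re) (him : z.im = w.im) : z = w := by
  cases k
  · exact hre
  · exact Complexification.ext hre him

theorem ofReal_add (a b : L) : (ofReal (a + b) : Scalar k L) = ofReal a + ofReal b :=
  ext (by simp) (by simp)

theorem ofReal_one : (ofReal 1 : Scalar k L) = 1 := ext (by simp) (by simp)

end Ring

end Scalar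

/-! ### The real part of the inner product -/

namespace InnerProduct

section

variable {k : ScalarKind} {L : Type u} [Ring L] [Lattice L]
  {H : Type v} [AddCommGroup H] [Module (Scalar k L) H] (ip : InnerProduct k L H)

/-- The real part of the inner product, as a biadditive map. -/
def reInner : H →+ H →+ L :=
  AddMonoidHom.mk' (fun x => AddMonoidHom.mk' (fun y => (ip.inner x y).re) fun y z => by
      rw [ip.conj_symm x, ip.add_left, ip.conj_symm x y, ip.conj_symm x z]; simp)
    fun x y => by ext z; simp [ip.add_left]

theorem reInner_apply (x y : H) : ip.reInner x y = (ip.inner x y).re := rfl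

theorem reInner_comm (x y : H) : ip.reInner x y = ip.reInner y x := by
  rw [reInner_apply, ip.conj_symm, Scalar.conj_re, reInner_apply]

theorem reInner_self_nonneg (x : H) : 0 ≤ ip.reInner x x := (ip.inner_self_nonneg x).1

theorem reInner_smul_left (a : L) (x y : H) :
    ip.reInner (Scalar.ofReal (k := k) a • x) y = a * ip.reInner x y := by
  simp [reInner_apply, ip.smul_left]

theorem reInner_smul_right (a : L) (x y : H) :
    ip.reInner x (Scalar.ofReal (k := k) a • y) = a * ip.reInner x y := by
  rw [reInner_comm, reInner_smul_left, reInner_comm]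

theorem pythagoras {w z : H} (h : ip.reInner w z = 0) :
    ip.reInner (w + z) (w + z) = ip.reInner w w + ip.reInner z z := by
  simp [ip.reInner_comm z w, h]

end

section

variable {k : ScalarKind} {L : Type u} [Ring L] [Algebra ℝ L] [ConditionallyCompleteLattice L]
  [UnitalFAlgebra L] {H : Type v} [AddCommGroup H] [Module (Scalar k L) H]
  (ip : InnerProduct k L H) (M : Submodule (Scalar k L) H)

open UnitalFAlgebra (mul_self_nonneg nonpos_of_forall_nsmul_le)

theorem norm_le_norm_iff (x y : H) :
    ip.norm x ≤ ip.norm y ↔ ip.reInner x x ≤ ip.reInner y y :=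
  sqrt_le_sqrt_iff (ip.reInner_self_nonneg x) (ip.reInner_self_nonneg y)

theorem norm_mul_self (x : H) : ip.norm x * ip.norm x = ip.reInner x x :=
  sqrt_mul_self (ip.reInner_self_nonneg x)

variable {M}

/-! ### Nearest points -/

/-- Nearest points attain the infimum of the distances, so square roots can be omitted. -/
theorem isNearestPoint_iff {x y : H} : ip.IsNearestPoint M x y ↔
    y ∈ M ∧ ∀ z ∈ M, ip.reInner (x - y) (x - y) ≤ ip.reInner (x - z) (x - z) := by
  refine and_congr_right fun hy => ⟨fun h z hz => ?_, fun h => IsLeast.isGLB ⟨⟨y, hy, rfl⟩, ?_⟩⟩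
  · exact (ip.norm_le_norm_iff _ _).1 (h.1 ⟨z, hz, rfl⟩)
  · rintro _ ⟨z, hz, rfl⟩
    exact (ip.norm_le_norm_iff _ _).2 (h z hz)

/-- If `w` is no longer than any `w - a z` with `a ∈ L`, then with `r = Re ⟨w, z⟩` the choice
`a = r / n` gives `2 n r² ≤ r² ⟨z, z⟩` for all `n`. -/
theorem reInner_eq_zero_of_forall_le {w z : H} (h : ∀ a : L, ip.reInner w w ≤
    ip.reInner (w - Scalar.ofReal (k := k) a • z) (w - Scalar.ofReal (k := k) a • z)) :
    ip.reInner w z = 0 := by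
  let : CommRing L := UnitalFAlgebra.toCommRing
  set r := ip.reInner w z with hr
  refine eq_zero_of_mul_self_nonpos (nonpos_of_forall_nsmul_le
    (y := r * r * ip.reInner z z) fun n => ?_)
  have hy : 0 ≤ r * r * ip.reInner z z :=
    mul_nonneg (mul_self_nonneg r) (ip.reInner_self_nonneg z)
  rcases n.eq_zero_or_pos with rfl | hn
  · simpa using hy
  have hn0 : (0 : ℝ) < n := by positivity
  set c : L := algebraMap ℝ L (n : ℝ)⁻¹ with hc
  have hnc : (n : L) * c = 1 := by
    rw [hc, ← map_natCast (algebraMap ℝ L), ← map_mul, mul_inv_cancel₀ hn0.ne', map_one]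
  have h1 := h (c * r)
  simp only [map_sub, AddMonoidHom.sub_apply, reInner_smul_left, reInner_smul_right,
    ip.reInner_comm z w, ← hr] at h1
  rw [← sub_nonneg] at h1
  have hn1 : (0 : L) ≤ n := Nat.cast_nonneg n
  have h2 := mul_nonneg (mul_nonneg hn1 hn1) h1
  have h3 : 0 ≤ (n : L) * (r * r) := mul_nonneg hn1 (mul_self_nonneg r)
  rw [← sub_nonneg, nsmul_eq_mul]
  have h4 : r * r * ip.reInner z z - n * (r * r) =
      n * n * (ip.reInner w w - c * r * r - (c * r * r - c * r * (c * r * ip.reInner z z)) -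
        ip.reInner w w) + n * (r * r) := by
    linear_combination (2 * n * r ^ 2 - (n * c + 1) * r * r * ip.reInner z z) * hnc
  rw [h4]
  exact add_nonneg h2 h3

/-- The real part of `⟨w, a z⟩` for `a = ⟨w, z⟩` is the squared modulus of `a`, so the real parts
control the inner product. -/
theorem inner_eq_zero_of_reInner_eq_zero {w : H} (h : ∀ z ∈ M, ip.reInner w z = 0) {z : H}
    (hz : z ∈ M) : ip.inner w z = 0 := by
  have h1 := h _ (M.smul_mem (ip.inner w z) hz)
  rw [reInner_comm, reInner_apply, ip.smul_left, ip.conj_symm z w, Scalar.mul_re, Scalar.conj_re,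
    Scalar.conj_im, mul_neg, sub_neg_eq_add] at h1
  have h2 := mul_self_nonneg (ip.inner w z).re
  have h3 := mul_self_nonneg (ip.inner w z).im
  obtain ⟨h4, h5⟩ := (add_eq_zero_iff_of_nonneg h2 h3).1 h1
  exact Scalar.ext (by rw [Scalar.zero_re]; exact eq_zero_of_mul_self_nonpos h4.le)
    (by rw [Scalar.zero_im]; exact eq_zero_of_mul_self_nonpos h5.le)

theorem isNearestPoint_iff_inner_eq_zero {x y : H} (hy : y ∈ M) :
    ip.IsNearestPoint M x y ↔ ∀ z ∈ M, ip.inner (x - y) z = 0 := by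
  rw [isNearestPoint_iff]
  constructor
  · rintro ⟨-, h⟩ z hz
    refine ip.inner_eq_zero_of_reInner_eq_zero (fun z hz => ?_) hz
    refine ip.reInner_eq_zero_of_forall_le fun a => ?_
    rw [sub_sub]
    exact h _ (M.add_mem hy (M.smul_mem _ hz))
  · refine fun h => ⟨hy, fun z hz => ?_⟩
    have h1 : ip.reInner (x - y) (y - z) = 0 := by
      rw [reInner_apply, h _ (M.sub_mem hy hz), Scalar.zero_re]
    rw [← sub_add_sub_cancel x y z, ip.pythagoras h1]
    exact le_add_of_nonneg_right (ip.reInner_self_nonneg _)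

/-- Gluing `z` and `w` along an idempotent of `L` gives a point of `M` at least as near to `x` as
both. -/
theorem exists_mem_reInner_le (x : H) {z w : H} (hz : z ∈ M) (hw : w ∈ M) :
    ∃ y ∈ M, ip.reInner (x - y) (x - y) ≤ ip.reInner (x - z) (x - z) ∧
      ip.reInner (x - y) (x - y) ≤ ip.reInner (x - w) (x - w) := by
  let : CommRing L := UnitalFAlgebra.toCommRing
  obtain ⟨p, hpp, hpf⟩ := exists_idempotent_mul_eq_posPart
    (ip.reInner (x - w) (x - w) - ip.reInner (x - z) (x - z))
  have h1 : ∀ v : H, v = Scalar.ofReal (k := k) p • v + Scalar.ofReal (k := k) (1 - p) • v :=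
    fun v => by rw [← add_smul, ← Scalar.ofReal_add, add_sub_cancel, Scalar.ofReal_one, one_smul]
  have h2 : x - (Scalar.ofReal (k := k) p • z + Scalar.ofReal (k := k) (1 - p) • w) =
      Scalar.ofReal (k := k) p • (x - z) + Scalar.ofReal (k := k) (1 - p) • (x - w) := by
    conv_lhs => rw [h1 x]
    rw [smul_sub, smul_sub]
    abel
  refine ⟨_, M.add_mem (M.smul_mem (Scalar.ofReal p) hz)
    (M.smul_mem (Scalar.ofReal (1 - p)) hw), ?_⟩
  have h3 : ip.reInner
      (Scalar.ofReal (k := k) p • (x - z) + Scalar.ofReal (k := k) (1 - p) • (x - w))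
      (Scalar.ofReal (k := k) p • (x - z) + Scalar.ofReal (k := k) (1 - p) • (x - w)) =
      ip.reInner (x - w) (x - w) -
        (ip.reInner (x - w) (x - w) - ip.reInner (x - z) (x - z))⁺ := by
    rw [← hpf]
    simp only [map_add, AddMonoidHom.add_apply, reInner_smul_left, reInner_smul_right]
    rw [ip.reInner_comm (x - w) (x - z)]
    linear_combination (ip.reInner (x - z) (x - z) - 2 * ip.reInner (x - z) (x - w) +
      ip.reInner (x - w) (x - w)) * hpp
  rw [h2, h3]
  exact ⟨sub_le_comm.1 (le_posPart _), sub_le_self _ (posPart_nonneg _)⟩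

/-- If `E` decreases to zero, so do the squares of the multiples of its elements. The square root
turns the claim into one about lower bounds of `E`, which need not be directed. -/
theorem nonpos_of_forall_le_nsmul_mul_self {E : Set L} (hE : DecreasesToZero E) {c : L} (n : ℕ)
    (h : ∀ e ∈ E, c ≤ ((n + 1) • e) * ((n + 1) • e)) : c ≤ 0 := by
  have hn0 : (0 : ℝ) < (n + 1 : ℕ) := by positivity
  have hs := sqrt_nonneg (posPart_nonneg c)
  have h1 : ((n + 1 : ℕ) : ℝ)⁻¹ • sqrt c⁺ ∈ lowerBounds E := fun e he => by
    have he0 : 0 ≤ (n + 1) • e := nsmul_nonneg (hE.1 e he) _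
    have h2 : sqrt c⁺ ≤ (n + 1) • e := le_of_mul_self_le_mul_self hs he0 (by
      rw [sqrt_mul_self (posPart_nonneg c)]
      exact sup_le (h e he) (mul_self_nonneg _))
    rw [← Nat.cast_smul_eq_nsmul ℝ] at h2
    have h3 := smul_le_smul_of_nonneg_left h2 (inv_nonneg.2 hn0.le)
    rwa [smul_smul, inv_mul_cancel₀ hn0.ne', one_smul] at h3
  have h4 : sqrt c⁺ ≤ 0 := by
    have := smul_le_smul_of_nonneg_left (hE.2.2 h1) hn0.le
    rwa [smul_smul, mul_inv_cancel₀ hn0.ne', one_smul, smul_zero] at this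
  have h5 : c⁺ = 0 := by
    rw [← sqrt_mul_self (posPart_nonneg c), le_antisymm h4 hs, mul_zero]
  exact posPart_eq_zero.1 h5

/-- The norm of a limit, in the form needed here: if the points `s i` are eventually at most as far
from `x` as `z`, so is their limit `y`. The inequality `n |a + b|² ≤ (n + 1) |a|² + (n + 1)² |b|²`
replaces the triangle inequality. -/
theorem reInner_sub_le_of_netTendsto {I : Type w} [Preorder I] [IsDirected I (· ≤ ·)] {s : I → H}
    {x y z : H} (hs : NetTendsto ip.norm s y) (i₀ : I)
    (h : ∀ i, i₀ ≤ i → ip.reInner (x - s i) (x - s i) ≤ ip.reInner (x - z) (x - z)) :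
    ip.reInner (x - y) (x - y) ≤ ip.reInner (x - z) (x - z) := by
  let : CommRing L := UnitalFAlgebra.toCommRing
  obtain ⟨E, hE, hsE⟩ := hs
  rw [← sub_nonpos]
  refine nonpos_of_forall_nsmul_le (y := ip.reInner (x - z) (x - z)) fun n => ?_
  rw [← sub_nonpos]
  refine nonpos_of_forall_le_nsmul_mul_self hE n fun e he => ?_
  obtain ⟨j, hj⟩ := hsE e he
  obtain ⟨i, hi₀, hji⟩ := exists_ge_ge i₀ j
  have h1 := h i hi₀
  have h2 : ip.reInner (s i - y) (s i - y) ≤ e * e := by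
    rw [← norm_mul_self]
    exact mul_self_le_mul_self (sqrt_nonneg (ip.reInner_self_nonneg _)) (hj i hji)
  have h3 := ip.reInner_self_nonneg ((x - s i) - n • (s i - y))
  have h4 := ip.reInner_self_nonneg (s i - y)
  rw [← sub_add_sub_cancel x (s i) y]
  generalize x - s i = a at *
  generalize s i - y = b at *
  generalize ip.reInner (x - z) (x - z) = f at *
  simp only [map_sub, AddMonoidHom.sub_apply, map_add, AddMonoidHom.add_apply, map_nsmul,
    AddMonoidHom.nsmul_apply, ip.reInner_comm b a, nsmul_eq_mul, Nat.cast_add, Nat.cast_one]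
    at h1 h2 h3 h4 ⊢
  have hn : (0 : L) ≤ n := Nat.cast_nonneg n
  have hn1 : (0 : L) ≤ n + 1 := add_nonneg hn zero_le_one
  rw [← sub_nonneg] at h1 h2 ⊢
  have h5 := add_nonneg (add_nonneg (mul_nonneg hn1 h1) (mul_nonneg (mul_nonneg hn1 hn1) h2))
    (add_nonneg h3 (mul_nonneg hn1 h4))
  refine h5.trans_eq ?_
  ring

/-- The net of all points of `M`, directed by decreasing distance to `x`, is Cauchy by the
parallelogram law, and its limit is nearest to `x`. -/
theorem exists_isNearestPoint (hH : ip.IsHilbert) (hM : NetClosed ip.norm (M : Set H)) (x : H) :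
    ∃ y, ip.IsNearestPoint M x y := by
  let : CommRing L := UnitalFAlgebra.toCommRing
  set φ : H → L := fun z => ip.reInner (x - z) (x - z) with hφ
  -- The lift only adjusts the universe of the index set.
  let : Preorder (ULift.{u} M) := Preorder.lift fun z => OrderDual.toDual (φ z.down)
  have : IsDirected (ULift.{u} M) (· ≤ ·) := ⟨fun z w => by
    obtain ⟨y, hy, h1, h2⟩ := ip.exists_mem_reInner_le x z.down.2 w.down.2
    exact ⟨⟨⟨y, hy⟩⟩, h1, h2⟩⟩
  set s : ULift.{u} M → H := fun z => z.down with hs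
  have hbdd : BddBelow (φ '' M) :=
    ⟨0, by rintro _ ⟨z, -, rfl⟩; exact ip.reInner_self_nonneg _⟩
  set δ : L := sInf (φ '' M) with hδ
  have hδle : ∀ z ∈ M, δ ≤ φ z := fun z hz => csInf_le hbdd ⟨z, hz, rfl⟩
  have hδ0 : ∀ z ∈ M, 0 ≤ (4 : L) * (φ z - δ) := fun z hz =>
    mul_nonneg (Nat.cast_nonneg (α := L) 4) (sub_nonneg.2 (hδle z hz))
  have hcauchy : NetCauchy ip.norm s := by
    refine ⟨{e | ∃ z ∈ M, e = sqrt (4 * (φ z - δ))}, ⟨?_, ?_, fun d hd => ?_⟩, ?_⟩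
    · rintro _ ⟨z, hz, rfl⟩
      exact sqrt_nonneg (hδ0 z hz)
    · rintro _ ⟨z, hz, rfl⟩
      exact sqrt_nonneg (hδ0 z hz)
    · have h1 : ∀ z ∈ M, d⁺ * d⁺ ≤ 4 * (φ z - δ) := fun z hz => by
        rw [← sqrt_mul_self (hδ0 z hz)]
        exact mul_self_le_mul_self (posPart_nonneg d)
          (sup_le (hd ⟨z, hz, rfl⟩) (sqrt_nonneg (hδ0 z hz)))
      have h2 : δ + (4⁻¹ : ℝ) • (d⁺ * d⁺) ≤ δ := by
        refine le_csInf ⟨_, 0, M.zero_mem, rfl⟩ ?_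
        rintro _ ⟨z, hz, rfl⟩
        have h3 := smul_le_smul_of_nonneg_left (h1 z hz) (show (0 : ℝ) ≤ 4⁻¹ by norm_num)
        have h4 : (4⁻¹ : ℝ) • (4 * (φ z - δ)) = φ z - δ := by
          rw [show (4 : L) = algebraMap ℝ L 4 from (map_ofNat _ 4).symm, ← Algebra.smul_def, smul_smul]
          norm_num
        rw [h4] at h3
        rwa [add_comm, ← le_sub_iff_add_le]
      have h5 : d⁺ * d⁺ ≤ 0 := by
        have h6 := smul_le_smul_of_nonneg_left ((add_le_iff_nonpos_right δ).1 h2)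
          (show (0 : ℝ) ≤ 4 by norm_num)
        rwa [smul_smul, mul_inv_cancel₀ four_ne_zero, one_smul, smul_zero] at h6
      exact posPart_eq_zero.1 (eq_zero_of_mul_self_nonpos h5)
    · rintro _ ⟨z₀, hz₀, rfl⟩
      refine ⟨⟨⟨z₀, hz₀⟩⟩, fun z w hz hw => ?_⟩
      have hz' : φ z.down ≤ φ z₀ := hz
      have hw' : φ w.down ≤ φ z₀ := hw
      refine (sqrt_le_sqrt_iff (ip.reInner_self_nonneg _) (hδ0 z₀ hz₀)).2 ?_
      set c : Scalar k L := Scalar.ofReal (algebraMap ℝ L 2⁻¹) with hc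
      have hcc : c + c = 1 := by
        rw [hc, ← Scalar.ofReal_add, ← map_add, ← Scalar.ofReal_one]
        norm_num
      have hm : c • (z.down + w.down : H) ∈ M := M.smul_mem _ (M.add_mem z.down.2 w.down.2)
      have h1 := hδle _ hm
      have h2 : (x - c • (z.down + w.down : H)) + (x - c • (z.down + w.down : H)) =
          (x - z.down) + (x - w.down) := by
        have : c • (z.down + w.down : H) + c • (z.down + w.down : H) = z.down + w.down := by
          rw [← add_smul, hcc, one_smul]
        rw [sub_add_sub_comm, this, sub_add_sub_comm]
      have h3 : (4 : L) * φ (c • (z.down + w.down : H)) =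
          ip.reInner ((x - z.down) + (x - w.down)) ((x - z.down) + (x - w.down)) := by
        rw [← h2]
        simp only [hφ, map_add, AddMonoidHom.add_apply]
        ring
      have h4 : ip.reInner (s z - s w) (s z - s w) =
          2 * φ z.down + 2 * φ w.down - 4 * φ (c • (z.down + w.down : H)) := by
        rw [h3, ← sub_sub_sub_cancel_left _ _ x]
        simp only [hφ, hs, map_sub, AddMonoidHom.sub_apply, map_add, AddMonoidHom.add_apply]
        ring
      rw [← sub_nonneg] at hz' hw' h1
      rw [h4, ← sub_nonneg]
      have h5 := add_nonneg (add_nonneg (add_nonneg hz' hz') (add_nonneg hw' hw'))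
        (mul_nonneg (Nat.cast_nonneg (α := L) 4) h1)
      refine h5.trans_eq ?_
      push_cast
      ring
  obtain ⟨y, hy⟩ := hH (ULift.{u} M) s hcauchy
  have hyM : y ∈ M := hM (ULift.{u} M) s y (fun z => z.down.2) hy
  refine ⟨y, ip.isNearestPoint_iff.2 ⟨hyM, fun z hz => ?_⟩⟩
  exact ip.reInner_sub_le_of_netTendsto hy ⟨⟨z, hz⟩⟩ fun i hi => hi

/-! ### The orthogonal decomposition -/

theorem isCompl_orthogonal (hH : ip.IsHilbert) (hM : NetClosed ip.norm (M : Set H)) :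
    IsCompl M (ip.orthogonal M) := by
  refine ⟨Submodule.disjoint_def.2 fun x hx hx' => ip.definite x (hx' x hx),
    codisjoint_iff.2 (eq_top_iff.2 fun x _ => ?_)⟩
  obtain ⟨y, hy⟩ := ip.exists_isNearestPoint hH hM x
  exact Submodule.mem_sup.2
    ⟨y, hy.1, x - y, (ip.isNearestPoint_iff_inner_eq_zero hy.1).1 hy, add_sub_cancel _ _⟩

theorem isContractive_of_norm_le {T : H → H} (h : ∀ x, ip.norm (T x) ≤ ip.norm x) :
    IsContractive ip.norm T := by
  have h1 : (1 : L) ∈ {c : L | 0 ≤ c ∧ ∀ x, ip.norm (T x) ≤ c * ip.norm x} :=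
    ⟨zero_le_one, fun x => by rw [one_mul]; exact h x⟩
  exact ⟨⟨1, h1⟩, csInf_le ⟨0, fun c hc => hc.1⟩ h1⟩

end

end InnerProduct

end LHilbert

theorem theoremt {L : Type u} [Ring L] [Algebra ℝ L] [ConditionallyCompleteLattice L]
    [LHilbert.UnitalFAlgebra L] (k : LHilbert.ScalarKind)
    {H : Type v} [AddCommGroup H] [Module (LHilbert.Scalar k L) H]
    (ip : LHilbert.InnerProduct k L H) (hH : ip.IsHilbert)
    (M : Submodule (LHilbert.Scalar k L) H) (hM : LHilbert.NetClosed ip.norm (M : Set H)) :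
    (∀ x : H, ∃! y : H, ip.IsNearestPoint M x y) ∧
    (∀ x : H, ∀ y ∈ M, ip.IsNearestPoint M x y ↔ ∀ z ∈ M, ip.inner (x - y) z = 0) ∧
    IsCompl M (ip.orthogonal M) ∧
    ∃ P : H →ₗ[LHilbert.Scalar k L] H,
      (∀ x y : H, P x = y ↔ y ∈ M ∧ x - y ∈ ip.orthogonal M) ∧
      LHilbert.IsContractive ip.norm P ∧
      P ∘ₗ P = P ∧
      LinearMap.ker P = ip.orthogonal M ∧
      LinearMap.range P = M := by
  have hc := ip.isCompl_orthogonal hH hM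
  have hP : ∀ x y : H, M.projection _ hc x = y ↔ y ∈ M ∧ x - y ∈ ip.orthogonal M := by
    intro x y
    constructor
    · rintro rfl
      refine ⟨Submodule.projection_apply_mem hc x, ?_⟩
      rw [← Submodule.projection_apply_eq_zero_iff hc, map_sub,
        Submodule.projection_apply_of_mem_left hc (Submodule.projection_apply_mem hc x), sub_self]
    · rintro ⟨hy, hxy⟩
      rw [← Submodule.projection_apply_eq_zero_iff hc, map_sub,
        Submodule.projection_apply_of_mem_left hc hy, sub_eq_zero] at hxy
      exact hxy
  have hmem := fun x : H => (hP x _).1 rfl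
  refine ⟨fun x => ?_, fun x y hy => ip.isNearestPoint_iff_inner_eq_zero hy, hc,
    M.projection _ hc, hP, ip.isContractive_of_norm_le fun x => ?_, ?_,
    Submodule.ker_projection hc, Submodule.range_projection hc⟩
  · refine ⟨M.projection _ hc x,
      (ip.isNearestPoint_iff_inner_eq_zero (hmem x).1).2 (hmem x).2, fun y hy => ?_⟩
    exact ((hP x y).2 ⟨hy.1, (ip.isNearestPoint_iff_inner_eq_zero hy.1).1 hy⟩).symm
  · rw [ip.norm_le_norm_iff]
    have h1 : ip.reInner (x - M.projection _ hc x) (M.projection _ hc x) = 0 := by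
      rw [ip.reInner_apply, (hmem x).2 _ (hmem x).1, LHilbert.Scalar.zero_re]
    have h2 := ip.pythagoras h1
    rw [sub_add_cancel] at h2
    rw [h2]
    exact le_add_of_nonneg_left (ip.reInner_self_nonneg _)
  · ext x
    exact Submodule.projection_apply_of_mem_left hc (hmem x).1
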